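/- For $\beta>0$ and $\kappa>0$ let $$F_{\beta,\kappa}(\varphi)=\frac18\int_0^1\Big(\varphi'(x)^2+\frac1{\beta^2}\sin^2\varphi(x)\Big)dx-\frac{\kappa}{2}\int_0^1\varphi'(x)\,dx,\qquad \varphi\in\mathcal J=\{\varphi\in H^1((0,1)):\ \varphi(0)=0\},$$ where elements of $H^1((0,1))$ are identified with their continuous representatives on $[0,1]$. Fix $\tilde\kappa>\frac1\pi$ and, for each $\beta>0$, put $\kappa=\tilde\kappa/\beta$. Then the following hold. (i) There is a unique $\tilde\alpha_0>0$ such that $\int_0^{\pi/2}\sqrt{\tilde\alpha_0^2+\sin^2y}\,dy=\tilde\kappa\pi$, and $\tilde\alpha_0\le 2\tilde\kappa$. (ii) There are constants $\beta_0>0$, $0<c<C$ and $M>0$, depending only on $\tilde\kappa$, such that for every $0<\beta<\beta_0$ every minimizer $\varphi_\beta$ of $F_{\beta,\kappa}$ in $\mathcal J$ is $C^\infty$ on $[0,1]$; there is a unique $T\in(0,1)$ with $\varphi_\beta(T)=\pi$; and, for this $T$, $$\varphi_\beta(x+T)=\pi+\varphi_\beta(x)\ \text{ for all }x\in[0,1-T],\qquad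 \frac c\beta\le\Big\lfloor\frac1T\Big\rfloor\le\frac C\beta,\qquad \Big|F_{\beta,\kappa}(\varphi_\beta)+\frac{\tilde\alpha_0^2}{8\beta^2}\Big|\le\frac M\beta .$$ (iii) There is a unique $C^2$ function $\varphi_0$ on $[0,\infty)$ with $\varphi_0''=\sin\varphi_0\cos\varphi_0$ in $(0,\infty)$, $\varphi_0(0)=0$, $\varphi_0'(0)=\tilde\alpha_0$, and it is $C^\infty$ on $[0,\infty)$. As $\beta\to0$, the functions $\tilde\varphi_\beta(x)=\varphi_\beta(\beta x)$, defined on $[0,1/\beta]$, converge to $\varphi_0$ in $C^\infty(K)$ for every compact $K\subset[0,\infty)$: for every integer $k\ge0$ the $k$-th derivatives converge uniformly on $K$, uniformly with respect to the choice of the minimizers $\varphi_\beta$. -/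

import Mathlib

open Real Set MeasureTheory
open scoped ContDiff

noncomputable section

namespace Stripes

/-- Lebesgue measure on the open interval `(0,1)`. -/
def unitVol : Measure ℝ := volume.restrict (Ioo (0 : ℝ) 1)

/-- `g` is a weak derivative of `u` on the open interval `(0,1)`: integration by parts holds
against every smooth test function with compact support in `(0,1)`. -/
def IsWeakDeriv (u g : ℝ → ℝ) : Prop :=
  ∀ η : ℝ → ℝ, ContDiff ℝ ∞ η → HasCompactSupport η → tsupport η ⊆ Ioo (0 : ℝ) 1 →
    ∫ x in (0 : ℝ)..1, u x * deriv η x = -∫ x in (0 : ℝ)..1, g x * η x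

/-- `u` belongs to the Sobolev space `H¹((0,1))`. -/
def MemH1 (u : ℝ → ℝ) : Prop :=
  MemLp u 2 unitVol ∧ ∃ g : ℝ → ℝ, MemLp g 2 unitVol ∧ IsWeakDeriv u g

/-- A square integrable weak derivative of `u` on `(0,1)`. For `u` in `H¹((0,1))` it is unique up
to equality almost everywhere on `(0,1)`; for other `u` it is a junk value. -/
def weakDeriv (u : ℝ → ℝ) : ℝ → ℝ :=
  Classical.epsilon fun g : ℝ → ℝ => MemLp g 2 unitVol ∧ IsWeakDeriv u g

/-- The space `𝒥 = {φ ∈ H¹((0,1)) ; φ(0) = 0}`. An element of `H¹((0,1))` is represented by its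
continuous representative on `[0,1]`; the values outside `[0,1]` play no role. -/
def spaceJ : Set (ℝ → ℝ) :=
  {φ | MemH1 φ ∧ ContinuousOn φ (Icc (0 : ℝ) 1) ∧ φ 0 = 0}

/-- The energy
`F_{β,κ}(φ) = (1/8) ∫₀¹ (φ'² + β⁻² sin² φ) dx - (κ/2) ∫₀¹ φ' dx`. -/
def energyF (β κ : ℝ) (φ : ℝ → ℝ) : ℝ :=
  1 / 8 * (∫ x in (0 : ℝ)..1, (weakDeriv φ x ^ 2 + 1 / β ^ 2 * sin (φ x) ^ 2))
    - κ / 2 * ∫ x in (0 : ℝ)..1, weakDeriv φ x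

/-- `φ` is a minimizer of `F_{β,κ}` in `𝒥`. -/
def IsMinimizer (β κ : ℝ) (φ : ℝ → ℝ) : Prop :=
  φ ∈ spaceJ ∧ ∀ ψ ∈ spaceJ, energyF β κ φ ≤ energyF β κ ψ

/-- `φ` solves `φ'' = sin φ cos φ` in `(0,∞)`, `φ(0) = 0`, `φ'(0) = α`, and is of class `C²` on
`[0,∞)` (with one-sided derivatives at `0`). -/
structure IsProfile (α : ℝ) (φ : ℝ → ℝ) : Prop where
  contDiffOn : ContDiffOn ℝ 2 φ (Ici 0)
  ode : ∀ x ∈ Ioi (0 : ℝ), iteratedDerivWithin 2 φ (Ici 0) x = sin (φ x) * cos (φ x)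
  map_zero : φ 0 = 0
  slope_zero : derivWithin φ (Ici 0) 0 = α

end Stripes

end

/-! The first variation turns a minimizer, after the rescaling u(x) = φ(βx), into a solution of u''
= sin u cos u with u(0) = 0 and the natural condition u'(1/β) = 2κt (`IsMinimizer.euler_lagrange`).
Since u'² - sin² u is conserved and the final slope is positive, u' = √(α² + sin² u) with α > 0: the
minimizer is one of the explicit curves `profile α`, leaving only the parameter α unknown
(`IsMinimizer.eq_profile`).

To locate α, complete the square against the speed of slope α₀ (`energyF_eq_of_eqOn_profile`). The
energy is -α₀²/(8β²), plus a boundary term `potential`/β, plus the mean of (speed α - speed α₀)²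
over 8β². The equation defining α₀ says exactly that the integrand of `potential` has zero mean over
a period, so the boundary term is O(1/β) (`exists_potential_bound`). Comparison with the competitor
`profile α₀` then gives both the energy estimate and (α - α₀)² ≤ Dβ (`exists_minimizer_bounds`).

The rest concerns `profile α` alone. It is the inverse of the arrival time, whose integrand is
π-periodic, hence the quasi-periodicity with T = β · `arrival α π`. Gronwall's inequality, and the
fact that all derivatives are smooth functions of (u, u'), give convergence of every derivative as α
→ α₀. -/

namespace Stripes

/-! ### Speed, arrival time and profile -/

/-- The velocity `√(α² + sin² y)` of the profile with initial slope `α` when it is at height `y`. -/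
noncomputable def speed (α y : ℝ) : ℝ := √(α ^ 2 + sin y ^ 2)

theorem sq_speed (α y : ℝ) : speed α y ^ 2 = α ^ 2 + sin y ^ 2 :=
  sq_sqrt (by positivity)

theorem speed_nonneg (α y : ℝ) : 0 ≤ speed α y := sqrt_nonneg _

theorem speed_pos {α : ℝ} (hα : 0 < α) (y : ℝ) : 0 < speed α y :=
  sqrt_pos.2 (by positivity)

theorem continuous_speed (α : ℝ) : Continuous (speed α) := by
  unfold speed; fun_prop

theorem speed_periodic (α : ℝ) : Function.Periodic (speed α) π := fun y => by
  simp [speed, sin_add_pi]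

theorem le_speed {α : ℝ} (y : ℝ) : α ≤ speed α y :=
  le_sqrt_of_sq_le (by nlinarith [sq_nonneg (sin y)])

theorem speed_le (α y : ℝ) : speed α y ≤ √(α ^ 2 + 1) :=
  sqrt_le_sqrt (by nlinarith [sin_sq_le_one y])

theorem speed_eq_norm (α y : ℝ) : speed α y = ‖(⟨α, sin y⟩ : ℂ)‖ := by
  rw [Complex.norm_eq_sqrt_sq_add_sq]; rfl

/-- Reverse triangle inequality for the plane vectors (α, sin y), with sine 1-Lipschitz. In the
Gronwall estimate this serves both as Lipschitz bound in y and as error bound in α. -/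
theorem abs_speed_sub_le (α α' y y' : ℝ) : |speed α y - speed α' y'| ≤ |α - α'| + |y - y'| := by
  rw [speed_eq_norm, speed_eq_norm]
  refine (abs_norm_sub_norm_le _ _).trans ((Complex.norm_le_abs_re_add_abs_im _).trans ?_)
  have := abs_sin_sub_sin_le y y'
  simpa using this

/-- The time at which the profile with initial slope `α` reaches the height `θ`. -/
noncomputable def arrival (α θ : ℝ) : ℝ := ∫ y in (0 : ℝ)..θ, (speed α y)⁻¹

theorem inv_speed_periodic (α : ℝ) : Function.Periodic (fun y => (speed α y)⁻¹) π := fun y => by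
  simp [speed_periodic α y]

section Arrival

variable {α : ℝ} (hα : 0 < α)
include hα

theorem continuous_inv_speed : Continuous fun y => (speed α y)⁻¹ :=
  (continuous_speed α).inv₀ fun y => (speed_pos hα y).ne'

theorem hasDerivAt_arrival (θ : ℝ) : HasDerivAt (arrival α) (speed α θ)⁻¹ θ :=
  ((continuous_inv_speed hα).integral_hasStrictDerivAt 0 θ).hasDerivAt

theorem strictMono_arrival : StrictMono (arrival α) :=
  strictMono_of_hasDerivAt_pos (hasDerivAt_arrival hα) fun θ => inv_pos.2 (speed_pos hα θ)

theorem surjective_arrival : Function.Surjective (arrival α) := by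
  have hc : Continuous (arrival α) :=
    continuous_iff_continuousAt.2 fun θ => (hasDerivAt_arrival hα θ).continuousAt
  have hi := (continuous_inv_speed hα).intervalIntegrable 0 π (μ := volume)
  have hp : ∀ y, 0 < (speed α y)⁻¹ := fun y => inv_pos.2 (speed_pos hα y)
  exact hc.surjective
    ((inv_speed_periodic α).tendsto_atTop_intervalIntegral_of_pos' hi hp pi_pos)
    ((inv_speed_periodic α).tendsto_atBot_intervalIntegral_of_pos' hi hp pi_pos)

/-- The integrand is π-periodic; inverting this identity gives the quasi-periodicity of the profile.
-/
theorem arrival_add_pi (θ : ℝ) : arrival α (θ + π) = arrival α θ + arrival α π := by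
  have := (inv_speed_periodic α).intervalIntegral_add_eq_add 0 θ
    fun a b => (continuous_inv_speed hα).intervalIntegrable a b
  simpa [arrival] using this

end Arrival

@[simp] theorem arrival_zero (α : ℝ) : arrival α 0 = 0 := by simp [arrival]

/-- The solution of `u' = √(α² + sin² u)`, `u(0) = 0`, as the inverse of the arrival time. -/
noncomputable def profile (α : ℝ) : ℝ → ℝ := Function.invFun (arrival α)

section Profile

variable {α : ℝ} (hα : 0 < α)
include hα

theorem arrival_profile (x : ℝ) : arrival α (profile α x) = x :=
  Function.rightInverse_invFun (surjective_arrival hα) x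

theorem profile_arrival (θ : ℝ) : profile α (arrival α θ) = θ :=
  Function.leftInverse_invFun (strictMono_arrival hα).injective θ

theorem profile_zero : profile α 0 = 0 := by
  simpa using profile_arrival hα 0

theorem strictMono_profile : StrictMono (profile α) := fun x y h => by
  rwa [← (strictMono_arrival hα).lt_iff_lt, arrival_profile hα, arrival_profile hα]

theorem continuous_profile : Continuous (profile α) :=
  (strictMono_profile hα).monotone.continuous_of_surjective fun θ => ⟨_, profile_arrival hα θ⟩

theorem hasDerivAt_profile (x : ℝ) : HasDerivAt (profile α) (speed α (profile α x)) x := by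
  simpa using HasDerivAt.of_local_left_inverse (continuous_profile hα).continuousAt
    (hasDerivAt_arrival hα (profile α x)) (inv_ne_zero (speed_pos hα _).ne')
    (Filter.Eventually.of_forall (arrival_profile hα))

theorem hasDerivAt_speed (y : ℝ) : HasDerivAt (speed α) (sin y * cos y / speed α y) y := by
  have h : HasDerivAt (fun y => α ^ 2 + sin y ^ 2) (2 * sin y * cos y) y := by
    simpa using ((hasDerivAt_sin y).pow 2).const_add (α ^ 2)
  have h0 : α ^ 2 + sin y ^ 2 ≠ 0 := by positivity
  refine (h.sqrt h0).congr_deriv ?_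
  unfold speed
  field_simp

theorem hasDerivAt_speed_profile (x : ℝ) : HasDerivAt (fun x => speed α (profile α x))
    (sin (profile α x) * cos (profile α x)) x :=
  ((hasDerivAt_speed hα (profile α x)).comp x (hasDerivAt_profile hα x)).congr_deriv
    (div_mul_cancel₀ _ (speed_pos hα _).ne')

theorem profile_add_arrival_pi (x : ℝ) : profile α (x + arrival α π) = profile α x + π := by
  rw [← profile_arrival hα (profile α x + π), arrival_add_pi hα, arrival_profile hα]

end Profile

/-! ### Solutions of u'' = sin u cos u: rigidity, stability, smoothness -/

theorem eq_zero_value_of_hasDerivWithinAt_zero {f : ℝ → ℝ} {L : ℝ} (hL : 0 < L)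
    (hf : ∀ x ∈ Icc 0 L, HasDerivWithinAt f 0 (Icc 0 L) x) : ∀ x ∈ Icc 0 L, f x = f 0 :=
  constant_of_derivWithin_zero (fun x hx => (hf x hx).differentiableWithinAt)
    fun x hx => (hf x (Ico_subset_Icc_self hx)).derivWithin
      (uniqueDiffOn_Icc hL x (Ico_subset_Icc_self hx))

/-- A solution of `u'' = sin u cos u` on `[0, L]` starting from `0` with positive slope is the
profile with that slope. -/
theorem trajectory_eq_profile {u v : ℝ → ℝ} {L α : ℝ} (hL : 0 < L) (hα : 0 < α)
    (hu : ∀ x ∈ Icc 0 L, HasDerivWithinAt u (v x) (Icc 0 L) x)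
    (hv : ∀ x ∈ Icc 0 L, HasDerivWithinAt v (sin (u x) * cos (u x)) (Icc 0 L) x)
    (hu0 : u 0 = 0) (hv0 : v 0 = α) :
    ∀ x ∈ Icc 0 L, u x = profile α x ∧ v x = speed α (u x) := by
  -- The first integral v² - sin² u is constant. It keeps v away from 0, so v retains its initial
  -- sign.
  have hsq : ∀ x ∈ Icc 0 L, v x ^ 2 = α ^ 2 + sin (u x) ^ 2 := by
    intro x hx
    have := eq_zero_value_of_hasDerivWithinAt_zero (f := fun x => v x ^ 2 - sin (u x) ^ 2) hL
      (fun x hx => by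
        refine (((hv x hx).pow 2).sub ((hu x hx).sin.pow 2)).congr_deriv ?_
        push_cast; ring) x hx
    simp [hu0, hv0] at this
    linarith
  have hne : ∀ x ∈ Icc 0 L, v x ≠ 0 := fun x hx h => by
    have := hsq x hx
    rw [h] at this
    nlinarith [sq_nonneg (sin (u x))]
  have hpos : ∀ x ∈ Icc 0 L, 0 < v x := by
    intro x hx
    by_contra! h
    have hc : ContinuousOn v (Icc 0 x) := fun y hy =>
      ((hv y ⟨hy.1, hy.2.trans hx.2⟩).continuousWithinAt).mono (Icc_subset_Icc_right hx.2)
    obtain ⟨y, hy, hy0⟩ := intermediate_value_Icc' hx.1 hc ⟨h, by rw [hv0]; exact hα.le⟩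
    exact hne y ⟨hy.1, hy.2.trans hx.2⟩ hy0
  have hspeed : ∀ x ∈ Icc 0 L, v x = speed α (u x) := fun x hx => by
    rw [speed, ← hsq x hx, sqrt_sq (hpos x hx).le]
  intro x hx
  refine ⟨?_, hspeed x hx⟩
  -- Separation of variables: along u the arrival time advances at unit rate.
  have := eq_zero_value_of_hasDerivWithinAt_zero (f := fun x => arrival α (u x) - x) hL
    (fun x hx => by
      refine (((hasDerivAt_arrival hα (u x)).comp_hasDerivWithinAt x (hu x hx)).sub
        (hasDerivWithinAt_id x _)).congr_deriv ?_
      rw [hspeed x hx, inv_mul_cancel₀ (speed_pos hα _).ne', sub_self]) x hx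
  simp only [hu0, arrival_zero, sub_zero, sub_eq_zero] at this
  rw [← profile_arrival hα (u x), this]

/-- Gronwall: `profile α` solves the first-order equation of slope α' up to an error |α - α'|, with
the same initial value. -/
theorem abs_profile_sub_le {α α' : ℝ} (hα : 0 < α) (hα' : 0 < α') {x : ℝ} (hx : 0 ≤ x) :
    |profile α x - profile α' x| ≤ |α - α'| * exp x := by
  have h := dist_le_of_approx_trajectories_ODE (v := fun _ => speed α') (K := 1)
    (f := profile α) (g := profile α') (f' := fun t => speed α (profile α t))
    (g' := fun t => speed α' (profile α' t)) (a := 0) (b := x) (εf := |α - α'|) (εg := 0) (δ := 0)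
    (fun _ => LipschitzWith.of_dist_le_mul fun y y' => by
      simpa [Real.dist_eq] using abs_speed_sub_le α' α' y y')
    (continuous_profile hα).continuousOn (fun t _ => (hasDerivAt_profile hα t).hasDerivWithinAt)
    (fun t _ => by simpa [Real.dist_eq] using abs_speed_sub_le α α' (profile α t) (profile α t))
    (continuous_profile hα').continuousOn (fun t _ => (hasDerivAt_profile hα' t).hasDerivWithinAt)
    (fun t _ => by simp) (by simp [profile_zero hα, profile_zero hα']) x ⟨hx, le_rfl⟩
  rw [Real.dist_eq] at h
  refine h.trans ?_
  rw [gronwallBound_of_K_ne_0 (by simp)]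
  simp only [NNReal.coe_one, one_mul, zero_mul, zero_add, add_zero, sub_zero, div_one]
  nlinarith [abs_nonneg (α - α')]

/-- Derivatives of every order of a solution of `u'' = sin u cos u` are fixed smooth functions of
`u` and `u'`. -/
theorem exists_iteratedDerivWithin_eq (k : ℕ) : ∃ Q : ℝ × ℝ → ℝ, ContDiff ℝ ∞ Q ∧
    ∀ (s : Set ℝ) (u v : ℝ → ℝ), UniqueDiffOn ℝ s →
      (∀ x ∈ s, HasDerivWithinAt u (v x) s x) →
      (∀ x ∈ s, HasDerivWithinAt v (sin (u x) * cos (u x)) s x) →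
      ∀ x ∈ s, iteratedDerivWithin k u s x = Q (u x, v x) := by
  induction k with
  | zero => exact ⟨Prod.fst, contDiff_fst, fun s u v _ _ _ x _ => by simp⟩
  | succ k ih =>
    obtain ⟨Q, hQ, h⟩ := ih
    -- The next function is the derivative of Q along the vector field (p₁, p₂) ↦ (p₂, sin p₁ cos
    -- p₁).
    refine ⟨fun p => fderiv ℝ Q p (p.2, sin p.1 * cos p.1), ?_, ?_⟩
    · refine (hQ.fderiv_right (m := ∞) le_rfl).clm_apply ?_
      exact contDiff_snd.prodMk (contDiff_fst.sin.mul contDiff_fst.cos)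
    · intro s u v hs hu hv x hx
      rw [iteratedDerivWithin_succ]
      have h1 : HasDerivWithinAt (fun x => Q (u x, v x))
          (fderiv ℝ Q (u x, v x) (v x, sin (u x) * cos (u x))) s x :=
        ((hQ.differentiable (by simp)) (u x, v x)).hasFDerivAt.comp_hasDerivWithinAt x
          ((hu x hx).prodMk (hv x hx))
      exact (h1.congr (h s u v hs hu hv) (h s u v hs hu hv x hx)).derivWithin (hs x hx)

theorem contDiffOn_of_trajectory {s : Set ℝ} {u v : ℝ → ℝ} (hs : UniqueDiffOn ℝ s)
    (hu : ∀ x ∈ s, HasDerivWithinAt u (v x) s x)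
    (hv : ∀ x ∈ s, HasDerivWithinAt v (sin (u x) * cos (u x)) s x) : ContDiffOn ℝ ∞ u s := by
  refine contDiffOn_of_differentiableOn_deriv (n := ⊤) fun k _ => ?_
  obtain ⟨Q, hQ, h⟩ := exists_iteratedDerivWithin_eq k
  have hd : DifferentiableOn ℝ (fun x => Q (u x, v x)) s :=
    (hQ.differentiable (by simp)).comp_differentiableOn
      (DifferentiableOn.prodMk (fun x hx => (hu x hx).differentiableWithinAt)
        fun x hx => (hv x hx).differentiableWithinAt)
  exact hd.congr (h s u v hs hu hv)

theorem contDiff_profile {α : ℝ} (hα : 0 < α) : ContDiff ℝ ∞ (profile α) :=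
  contDiffOn_univ.1 <| contDiffOn_of_trajectory uniqueDiffOn_univ
    (fun x _ => (hasDerivAt_profile hα x).hasDerivWithinAt)
    (fun x _ => (hasDerivAt_speed_profile hα x).hasDerivWithinAt)

/-! ### Weak derivatives on the unit interval -/

instance : IsFiniteMeasure unitVol := by unfold unitVol; infer_instance

theorem integral_zero_one_eq (f : ℝ → ℝ) : ∫ x in (0 : ℝ)..1, f x = ∫ x, f x ∂unitVol := by
  rw [intervalIntegral.integral_of_le zero_le_one, integral_Ioc_eq_integral_Ioo, unitVol]

theorem ae_unitVol_of_forall {p : ℝ → Prop} (h : ∀ x ∈ Icc (0 : ℝ) 1, p x) :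
    ∀ᵐ x ∂unitVol, p x :=
  (ae_restrict_mem measurableSet_Ioo).mono fun x hx => h x (Ioo_subset_Icc_self hx)

theorem memLp_of_continuousOn {f : ℝ → ℝ} (hf : ContinuousOn f (Icc 0 1)) {p : ENNReal} :
    MemLp f p unitVol := by
  obtain ⟨C, hC⟩ := isCompact_Icc.exists_bound_of_continuousOn hf
  exact MemLp.of_bound ((hf.mono Ioo_subset_Icc_self).aestronglyMeasurable measurableSet_Ioo) C
    (ae_unitVol_of_forall hC)

theorem integrable_of_continuousOn {f : ℝ → ℝ} (hf : ContinuousOn f (Icc 0 1)) :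
    Integrable f unitVol :=
  memLp_one_iff_integrable.1 (memLp_of_continuousOn hf)

/-- Smooth functions compactly supported in `(0, 1)`. -/
structure IsTest (η : ℝ → ℝ) : Prop where
  contDiff : ContDiff ℝ ∞ η
  hasCompactSupport : HasCompactSupport η
  tsupport_subset : tsupport η ⊆ Ioo 0 1

theorem IsTest.eq_zero {η : ℝ → ℝ} (h : IsTest η) {x : ℝ} (hx : x ∉ Ioo (0 : ℝ) 1) : η x = 0 :=
  image_eq_zero_of_notMem_tsupport fun h' => hx (h.tsupport_subset h')

theorem ae_eq_zero_of_forall_test {f : ℝ → ℝ} (hf : Integrable f unitVol)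
    (h : ∀ η, IsTest η → ∫ x in (0 : ℝ)..1, f x * η x = 0) : f =ᵐ[unitVol] 0 := by
  have := isOpen_Ioo.ae_eq_zero_of_integral_contDiff_smul_eq_zero (U := Ioo (0 : ℝ) 1)
    (μ := volume) (f := f) (IntegrableOn.locallyIntegrableOn hf) fun η h1 h2 h3 => by
      have hη : IsTest η := ⟨h1, h2, h3⟩
      rw [← setIntegral_eq_integral_of_forall_compl_eq_zero (s := Ioo (0 : ℝ) 1)
        fun x hx => by simp [hη.eq_zero hx]]
      have e := h η hη
      rw [integral_zero_one_eq, unitVol] at e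
      simpa [mul_comm] using e
  exact (ae_restrict_iff' measurableSet_Ioo).2 this

theorem MemH1.weakDeriv_spec {u : ℝ → ℝ} (hu : MemH1 u) :
    MemLp (weakDeriv u) 2 unitVol ∧ IsWeakDeriv u (weakDeriv u) :=
  Classical.epsilon_spec hu.2

/-- Two weak derivatives agree against every test function. This allows the arbitrary choice in
`weakDeriv` to be replaced by any explicit candidate. -/
theorem weakDeriv_ae_eq {u g : ℝ → ℝ} (hg : MemLp g 2 unitVol) (h : IsWeakDeriv u g) :
    weakDeriv u =ᵐ[unitVol] g := by
  obtain ⟨hm, hw⟩ := Classical.epsilon_spec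
    (p := fun g : ℝ → ℝ => MemLp g 2 unitVol ∧ IsWeakDeriv u g) ⟨g, hg, h⟩
  change MemLp (weakDeriv u) 2 unitVol at hm
  change IsWeakDeriv u (weakDeriv u) at hw
  have h0 := ae_eq_zero_of_forall_test (f := weakDeriv u - g)
    ((hm.sub hg).integrable (by norm_num)) fun η hη => by
      have e := (hw η hη.contDiff hη.hasCompactSupport hη.tsupport_subset).symm.trans
        (h η hη.contDiff hη.hasCompactSupport hη.tsupport_subset)
      have hηL : MemLp η 2 unitVol := memLp_of_continuousOn hη.contDiff.continuous.continuousOn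
      rw [integral_zero_one_eq, integral_zero_one_eq] at e
      rw [integral_zero_one_eq]
      have := integral_sub (hm.integrable_mul hηL) (hg.integrable_mul hηL)
      simp only [Pi.sub_apply, sub_mul, Pi.mul_apply] at this ⊢
      linarith
  filter_upwards [h0] with x hx
  simpa [sub_eq_zero] using hx

theorem isWeakDeriv_of_hasDerivAt {u w w' : ℝ → ℝ} (hu : EqOn u w (Icc 0 1))
    (hw : ∀ x, HasDerivAt w (w' x) x) (hc : Continuous w') : IsWeakDeriv u w' := by
  intro η h1 h2 h3
  have hη : IsTest η := ⟨h1, h2, h3⟩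
  have e : ∫ x in (0 : ℝ)..1, u x * deriv η x = ∫ x in (0 : ℝ)..1, w x * deriv η x :=
    intervalIntegral.integral_congr fun x hx => by
      rw [uIcc_of_le zero_le_one] at hx
      simp only [hu hx]
  have hd : ∀ x, HasDerivAt η (deriv η x) x := fun x =>
    ((h1.differentiable (by simp)) x).hasDerivAt
  rw [e, intervalIntegral.integral_mul_deriv_eq_deriv_mul (fun x _ => hw x) (fun x _ => hd x)
    (hc.intervalIntegrable _ _) ((h1.continuous_deriv (by simp)).intervalIntegrable _ _)]
  simp [hη.eq_zero]

theorem IsWeakDeriv.add_smul {u g w w' : ℝ → ℝ} (hu : MemLp u 2 unitVol)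
    (hg : MemLp g 2 unitVol) (h : IsWeakDeriv u g)
    (hw : ∀ x, HasDerivAt w (w' x) x) (hc : Continuous w') (t : ℝ) :
    IsWeakDeriv (fun x => u x + t * w x) (fun x => g x + t * w' x) := by
  intro η h1 h2 h3
  have e1 := h η h1 h2 h3
  have e2 := isWeakDeriv_of_hasDerivAt (fun x _ => rfl) hw hc η h1 h2 h3
  have hwc : Continuous w := continuous_iff_continuousAt.2 fun x => (hw x).continuousAt
  have hη : MemLp η 2 unitVol := memLp_of_continuousOn h1.continuous.continuousOn
  have hη' : MemLp (deriv η) 2 unitVol :=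
    memLp_of_continuousOn (h1.continuous_deriv (by simp)).continuousOn
  have hwL : MemLp w 2 unitVol := memLp_of_continuousOn hwc.continuousOn
  have hwL' : MemLp w' 2 unitVol := memLp_of_continuousOn hc.continuousOn
  simp only [integral_zero_one_eq] at e1 e2 ⊢
  have i1 := integral_add (hu.integrable_mul hη') ((hwL.integrable_mul hη').const_mul t)
  have i2 := integral_add (hg.integrable_mul hη) ((hwL'.integrable_mul hη).const_mul t)
  simp only [Pi.mul_apply, integral_const_mul] at i1 i2
  simp only [add_mul, mul_assoc]
  rw [i1, i2]
  linear_combination e1 + t * e2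

theorem exists_isTest_integral_eq_one : ∃ η, IsTest η ∧ ∫ x in (0 : ℝ)..1, η x = 1 := by
  let f : ContDiffBump (1 / 2 : ℝ) := ⟨1 / 8, 1 / 4, by norm_num, by norm_num⟩
  have hη : IsTest (f.normed volume) := by
    refine ⟨f.contDiff_normed, f.hasCompactSupport_normed, ?_⟩
    rw [f.tsupport_normed_eq, Real.closedBall_eq_Icc]
    intro x hx
    change x ∈ Icc (1 / 2 - 1 / 4) (1 / 2 + 1 / 4) at hx
    constructor <;> linarith [hx.1, hx.2]
  refine ⟨_, hη, ?_⟩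
  rw [integral_zero_one_eq, unitVol,
    setIntegral_eq_integral_of_forall_compl_eq_zero fun x hx => hη.eq_zero hx, f.integral_normed]

theorem IsTest.exists_Icc {η : ℝ → ℝ} (h : IsTest η) :
    ∃ a b : ℝ, 0 < a ∧ b < 1 ∧ ∀ x, x ∉ Icc a b → η x = 0 := by
  -- The added point guarantees a nonempty compact set, so that extreme points exist even when η =
  -- 0.
  have hK : IsCompact (insert (1 / 2) (tsupport η)) := h.hasCompactSupport.insert _
  have hsub : insert (1 / 2) (tsupport η) ⊆ Ioo (0 : ℝ) 1 :=
    insert_subset (by norm_num) h.tsupport_subset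
  obtain ⟨a, ha, ha'⟩ := hK.exists_isLeast (insert_nonempty _ _)
  obtain ⟨b, hb, hb'⟩ := hK.exists_isGreatest (insert_nonempty _ _)
  refine ⟨a, b, (hsub ha).1, (hsub hb).2, fun x hx => image_eq_zero_of_notMem_tsupport fun h' => ?_⟩
  exact hx ⟨ha' (mem_insert_of_mem _ h'), hb' (mem_insert_of_mem _ h')⟩

/-- Zero mean makes the primitive vanish again to the right of the support. This supplies the test
functions for the du Bois-Reymond argument. -/
theorem IsTest.primitive {η : ℝ → ℝ} (h : IsTest η) (h0 : ∫ x in (0 : ℝ)..1, η x = 0) :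
    IsTest fun x => ∫ y in (0 : ℝ)..x, η y := by
  have hd : ∀ x, HasDerivAt (fun x => ∫ y in (0 : ℝ)..x, η y) (η x) x := fun x =>
    (h.contDiff.continuous.integral_hasStrictDerivAt 0 x).hasDerivAt
  obtain ⟨a, b, ha, hb, hab⟩ := h.exists_Icc
  have hs : Function.support (fun x => ∫ y in (0 : ℝ)..x, η y) ⊆ Icc a b := by
    intro x hx
    by_contra hx'
    refine hx ?_
    rcases lt_or_ge x a with hxa | hxa
    · change ∫ y in (0 : ℝ)..x, η y = 0
      rw [intervalIntegral.integral_congr (g := fun _ => (0 : ℝ)), intervalIntegral.integral_zero]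
      intro y hy
      exact hab y fun hy' => absurd hy'.1 (not_le.2 (hy.2.trans_lt (max_lt ha hxa)))
    · have hxb : b < x := not_le.1 fun hle => hx' ⟨hxa, hle⟩
      have hi := h.contDiff.continuous.intervalIntegrable (μ := volume)
      change ∫ y in (0 : ℝ)..x, η y = 0
      rw [← intervalIntegral.integral_add_adjacent_intervals (hi 0 1) (hi 1 x), h0, zero_add,
        intervalIntegral.integral_congr (g := fun _ => (0 : ℝ)), intervalIntegral.integral_zero]
      intro y hy
      exact hab y fun hy' => absurd hy'.2 (not_le.2 ((lt_min hb hxb).trans_le hy.1))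
  refine ⟨?_, HasCompactSupport.of_support_subset_isCompact isCompact_Icc hs, ?_⟩
  · rw [contDiff_infty_iff_deriv]
    refine ⟨fun x => (hd x).differentiableAt, ?_⟩
    rw [funext fun x => (hd x).deriv]
    exact h.contDiff
  · exact (closure_minimal hs isClosed_Icc).trans fun x hx =>
      ⟨ha.trans_le hx.1, hx.2.trans_lt hb⟩

theorem eqOn_of_ae_unitVol_eq {f g : ℝ → ℝ} (h : f =ᵐ[unitVol] g) (hf : ContinuousOn f (Icc 0 1))
    (hg : ContinuousOn g (Icc 0 1)) : EqOn f g (Icc 0 1) := by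
  rw [unitVol, Measure.restrict_congr_set Ioo_ae_eq_Icc] at h
  exact Measure.eqOn_Icc_of_ae_eq _ zero_ne_one h hf hg

/-- A continuous function with vanishing weak derivative is constant. -/
theorem eq_zero_value_of_isWeakDeriv_zero {w : ℝ → ℝ} (hw : ContinuousOn w (Icc 0 1))
    (h : IsWeakDeriv w 0) : ∀ x ∈ Icc (0 : ℝ) 1, w x = w 0 := by
  obtain ⟨η₀, hη₀, h1⟩ := exists_isTest_integral_eq_one
  have hwL : MemLp w 2 unitVol := memLp_of_continuousOn hw
  set c := ∫ x in (0 : ℝ)..1, w x * η₀ x with hc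
  have hae : (fun x => w x - c) =ᵐ[unitVol] 0 := by
    refine ae_eq_zero_of_forall_test
      (integrable_of_continuousOn (hw.sub continuousOn_const)) fun η hη => ?_
    set m := ∫ x in (0 : ℝ)..1, η x with hm
    have hηc := hη.contDiff.continuous
    have hη₀c := hη₀.contDiff.continuous
    -- Subtracting m η₀ removes the mean of η, so the difference is the derivative of a test
    -- function and w integrates to 0 against it. That is orthogonality of w - c to η.
    have hθ : IsTest fun x => η x - m * η₀ x := by
      have hs : Function.support (fun x => η x - m * η₀ x) ⊆ tsupport η ∪ tsupport η₀ := by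
        intro x hx
        by_contra hx'
        simp only [mem_union, not_or] at hx'
        exact hx (by simp [image_eq_zero_of_notMem_tsupport hx'.1,
          image_eq_zero_of_notMem_tsupport hx'.2])
      have hK : IsCompact (tsupport η ∪ tsupport η₀) :=
        hη.hasCompactSupport.isCompact.union hη₀.hasCompactSupport.isCompact
      exact ⟨hη.contDiff.sub (contDiff_const.mul hη₀.contDiff),
        HasCompactSupport.of_support_subset_isCompact hK hs,
        (closure_minimal hs hK.isClosed).trans
          (union_subset hη.tsupport_subset hη₀.tsupport_subset)⟩
    have hθ0 : ∫ x in (0 : ℝ)..1, (η x - m * η₀ x) = 0 := by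
      rw [intervalIntegral.integral_sub (hηc.intervalIntegrable _ _)
        ((hη₀c.const_mul m).intervalIntegrable _ _), intervalIntegral.integral_const_mul,
        h1, ← hm, mul_one, sub_self]
    have hζ := hθ.primitive hθ0
    have e := h _ hζ.contDiff hζ.hasCompactSupport hζ.tsupport_subset
    have hd : deriv (fun x => ∫ y in (0 : ℝ)..x, (η y - m * η₀ y)) = fun x => η x - m * η₀ x :=
      funext fun x => (hθ.contDiff.continuous.deriv_integral _ 0 x)
    rw [hd] at e
    have hηL : MemLp η 2 unitVol := memLp_of_continuousOn hηc.continuousOn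
    have hη₀L : MemLp η₀ 2 unitVol := memLp_of_continuousOn hη₀c.continuousOn
    rw [integral_zero_one_eq] at hc hm e ⊢
    have i1 := integral_sub (hwL.integrable_mul hηL) ((hwL.integrable_mul hη₀L).const_mul m)
    have i2 := integral_sub (hwL.integrable_mul hηL)
      ((hηL.integrable (by norm_num)).const_mul c)
    simp only [Pi.mul_apply, integral_const_mul, ← hc, ← hm] at i1 i2
    simp only [Pi.zero_apply, zero_mul, intervalIntegral.integral_zero, neg_zero] at e
    simp only [sub_mul]
    rw [i2, mul_comm c, ← i1, ← e]
    exact integral_congr_ae (.of_forall fun x => by ring)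
  have heq : EqOn (fun x => w x - c) 0 (Icc 0 1) :=
    eqOn_of_ae_unitVol_eq hae (hw.sub continuousOn_const) continuousOn_const
  intro x hx
  have e1 := heq hx
  have e0 := heq (left_mem_Icc.2 zero_le_one)
  simp only [Pi.zero_apply] at e1 e0
  linarith

/-! ### First variation and the Euler–Lagrange equation -/

theorem energyF_eq_integral {u g : ℝ → ℝ} (hu : ContinuousOn u (Icc 0 1))
    (hg : MemLp g 2 unitVol) (h : weakDeriv u =ᵐ[unitVol] g) (β κ : ℝ) :
    energyF β κ u =
      ∫ x, (1 / 8 * (g x ^ 2 + 1 / β ^ 2 * sin (u x) ^ 2) - κ / 2 * g x) ∂unitVol := by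
  have hs : Integrable (fun x => 1 / β ^ 2 * sin (u x) ^ 2) unitVol :=
    integrable_of_continuousOn (by fun_prop)
  rw [energyF, integral_zero_one_eq, integral_zero_one_eq, ← integral_const_mul,
    ← integral_const_mul, ← integral_sub]
  · refine integral_congr_ae ?_
    filter_upwards [h] with x hx
    rw [hx]
  · refine (((hg.ae_eq h.symm).integrable_sq.add hs).const_mul _)
  · exact ((hg.ae_eq h.symm).integrable (by norm_num)).const_mul _

/-- Subtract the linear term: the derivative of what remains is at most 2|h| on the segment. With
this quadratic bound the first variation needs no differentiation under the integral sign. -/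
theorem sin_add_sq_le (a h : ℝ) : sin (a + h) ^ 2 ≤ sin a ^ 2 + h * sin (2 * a) + 2 * h ^ 2 := by
  have hd : ∀ x ∈ uIcc 0 h, HasDerivWithinAt (fun x => sin (a + x) ^ 2 - x * sin (2 * a))
      (sin (2 * (a + x)) - sin (2 * a)) (uIcc 0 h) x := fun x _ => by
    refine (((((hasDerivAt_id x).const_add a).sin.pow 2).sub
      ((hasDerivAt_id x).mul_const (sin (2 * a)))).congr_deriv ?_).hasDerivWithinAt
    rw [sin_two_mul (a + x)]
    simp
  have hb : ∀ x ∈ uIcc 0 h, ‖sin (2 * (a + x)) - sin (2 * a)‖ ≤ 2 * |h| := fun x hx => by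
    have h1 := abs_sub_left_of_mem_uIcc hx
    have h2 := abs_sin_sub_sin_le (2 * (a + x)) (2 * a)
    rw [show 2 * (a + x) - 2 * a = 2 * x by ring, abs_mul, abs_two] at h2
    rw [sub_zero, sub_zero] at h1
    rw [Real.norm_eq_abs]
    linarith
  have := (convex_uIcc 0 h).norm_image_sub_le_of_norm_hasDerivWithin_le hd hb left_mem_uIcc
    right_mem_uIcc
  simp only [add_zero, zero_mul, sub_zero, Real.norm_eq_abs] at this
  rw [mul_assoc, abs_mul_abs_self] at this
  linarith [le_abs_self (sin (a + h) ^ 2 - h * sin (2 * a) - sin a ^ 2)]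

theorem eq_zero_of_forall_quadratic_nonneg {A B : ℝ} (h : ∀ t : ℝ, 0 ≤ t * A + t ^ 2 * B) :
    A = 0 := by
  have hB : 0 < 2 * (|B| + 1) := by positivity
  -- B may have either sign; this denominator exceeds B and is positive, so the quadratic is
  -- negative here unless A = 0.
  have h1 := h (-A / (2 * (|B| + 1)))
  have h2 : -A / (2 * (|B| + 1)) * A + (-A / (2 * (|B| + 1))) ^ 2 * B
      = A ^ 2 * (B - 2 * (|B| + 1)) / (2 * (|B| + 1)) ^ 2 := by
    field_simp; ring
  rw [h2, le_div_iff₀ (by positivity), zero_mul] at h1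
  have h3 : B - 2 * (|B| + 1) < 0 := by linarith [le_abs_self B, abs_nonneg B]
  have h4 : A ^ 2 ≤ 0 := by nlinarith
  exact pow_eq_zero_iff two_ne_zero |>.1 (le_antisymm h4 (sq_nonneg A))

/-- The first variation of the energy at a minimizer vanishes. -/
theorem IsMinimizer.first_variation {β κ : ℝ} {φ η ζ : ℝ → ℝ} (h : IsMinimizer β κ φ)
    (hη : ∀ x, HasDerivAt η (ζ x) x) (hζ : Continuous ζ) (hη0 : η 0 = 0) :
    ∫ x, (1 / 4 * (weakDeriv φ x * ζ x) + 1 / (8 * β ^ 2) * (sin (2 * φ x) * η x)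
      - κ / 2 * ζ x) ∂unitVol = 0 := by
  obtain ⟨⟨hH, hφc, hφ0⟩, hmin⟩ := h
  obtain ⟨hg, hw⟩ := hH.weakDeriv_spec
  set g := weakDeriv φ with hgdef
  have hηc : Continuous η := continuous_iff_continuousAt.2 fun x => (hη x).continuousAt
  have hφL : MemLp φ 2 unitVol := memLp_of_continuousOn hφc
  have hζL : MemLp ζ 2 unitVol := memLp_of_continuousOn hζ.continuousOn
  have iA : Integrable (fun x => 1 / 4 * (g x * ζ x) + 1 / (8 * β ^ 2) * (sin (2 * φ x) * η x)
      - κ / 2 * ζ x) unitVol := by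
    refine (((hg.integrable_mul hζL).const_mul _).add ?_).sub
      ((hζL.integrable (by norm_num)).const_mul _)
    exact integrable_of_continuousOn (by fun_prop)
  have iB : Integrable (fun x => 1 / 8 * ζ x ^ 2 + 1 / (8 * β ^ 2) * (2 * η x ^ 2)) unitVol :=
    integrable_of_continuousOn (by fun_prop)
  have iE : Integrable (fun x => 1 / 8 * (g x ^ 2 + 1 / β ^ 2 * sin (φ x) ^ 2) - κ / 2 * g x)
      unitVol := by
    refine ((hg.integrable_sq.add ?_).const_mul _).sub ((hg.integrable (by norm_num)).const_mul _)
    exact integrable_of_continuousOn (by fun_prop)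
  -- The energy increment along φ + tη is nonnegative by minimality and at most tA + t²B, with A the
  -- integral to be shown zero.
  refine eq_zero_of_forall_quadratic_nonneg
    (B := ∫ x, (1 / 8 * ζ x ^ 2 + 1 / (8 * β ^ 2) * (2 * η x ^ 2)) ∂unitVol) fun t => ?_
  have hgt : MemLp (fun x => g x + t * ζ x) 2 unitVol := hg.add (hζL.const_mul t)
  have hwt := hw.add_smul hφL hg hη hζ t
  have hct : ContinuousOn (fun x => φ x + t * η x) (Icc 0 1) := by fun_prop
  have hle := hmin (fun x => φ x + t * η x)
    ⟨⟨memLp_of_continuousOn hct, _, hgt, hwt⟩, hct, by simp [hφ0, hη0]⟩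
  rw [energyF_eq_integral hφc hg (weakDeriv_ae_eq hg hw),
    energyF_eq_integral hct hgt (weakDeriv_ae_eq hgt hwt)] at hle
  have iEt : Integrable (fun x => 1 / 8 * ((g x + t * ζ x) ^ 2 +
      1 / β ^ 2 * sin (φ x + t * η x) ^ 2) - κ / 2 * (g x + t * ζ x)) unitVol := by
    refine ((hgt.integrable_sq.add ?_).const_mul _).sub
      ((hgt.integrable (by norm_num)).const_mul _)
    exact integrable_of_continuousOn (by fun_prop)
  have hmono := integral_mono iEt (iE.add ((iA.const_mul t).add (iB.const_mul (t ^ 2))))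
    fun x => by
      have h1 := sin_add_sq_le (φ x) (t * η x)
      have h2 : 0 ≤ 1 / (8 * β ^ 2) := by positivity
      have h3 := mul_le_mul_of_nonneg_left h1 h2
      have h4 : 1 / 8 * (1 / β ^ 2) = 1 / (8 * β ^ 2) := by field_simp
      simp only [Pi.add_apply]
      calc _ = 1 / 8 * (g x + t * ζ x) ^ 2 + 1 / (8 * β ^ 2) * sin (φ x + t * η x) ^ 2
            - κ / 2 * (g x + t * ζ x) := by rw [← h4]; ring
        _ ≤ 1 / 8 * (g x + t * ζ x) ^ 2 + 1 / (8 * β ^ 2) *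
              (sin (φ x) ^ 2 + t * η x * sin (2 * φ x) + 2 * (t * η x) ^ 2)
            - κ / 2 * (g x + t * ζ x) := by linarith
        _ = _ := by rw [← h4]; ring
  rw [integral_add' iE ((iA.const_mul t).add (iB.const_mul (t ^ 2))),
    integral_add' (iA.const_mul t) (iB.const_mul (t ^ 2)), integral_const_mul,
    integral_const_mul] at hmono
  linarith

/-- Euler–Lagrange equation of a minimizer, with its natural boundary condition at `1`. -/
theorem IsMinimizer.euler_lagrange {β κ : ℝ} {φ : ℝ → ℝ} (h : IsMinimizer β κ φ) :
    ∃ w G : ℝ → ℝ, EqOn φ w (Icc 0 1) ∧ (∀ x, HasDerivAt w (G x) x) ∧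
      (∀ x ∈ Icc (0 : ℝ) 1, HasDerivAt G (1 / β ^ 2 * (sin (w x) * cos (w x))) x) ∧
      G 1 = 2 * κ := by
  obtain ⟨hH, hφc, hφ0⟩ := h.1
  obtain ⟨hg, hw⟩ := hH.weakDeriv_spec
  obtain ⟨f, hfc, hf⟩ : ∃ f : ℝ → ℝ, Continuous f ∧ EqOn φ f (Icc 0 1) :=
    ⟨IccExtend zero_le_one ((Icc (0 : ℝ) 1).domRestrict φ),
      (continuousOn_iff_continuous_domRestrict.1 hφc).Icc_extend',
      fun x hx => (IccExtend_of_mem zero_le_one ((Icc (0 : ℝ) 1).domRestrict φ) hx).symm⟩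
  set s : ℝ → ℝ := fun x => 1 / (2 * β ^ 2) * sin (2 * f x) with hs
  have hsc : Continuous s := by fun_prop
  -- Basing the primitive at 1 kills the boundary term there for variations η with η(1) free; this
  -- is what produces the natural condition G 1 = 2κ.
  set S : ℝ → ℝ := fun x => ∫ y in (1 : ℝ)..x, s y with hS
  have hSd : ∀ x, HasDerivAt S (s x) x := fun x => (hsc.integral_hasStrictDerivAt 1 x).hasDerivAt
  have hSc : Continuous S := continuous_iff_continuousAt.2 fun x => (hSd x).continuousAt
  have hS1 : S 1 = 0 := intervalIntegral.integral_same
  set G : ℝ → ℝ := fun x => S x + 2 * κ with hG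
  have hGc : Continuous G := by fun_prop
  have hGL : MemLp G 2 unitVol := memLp_of_continuousOn hGc.continuousOn
  have hgG : weakDeriv φ =ᵐ[unitVol] G := by
    have := ae_eq_zero_of_forall_test (f := weakDeriv φ - G)
      ((hg.sub hGL).integrable (by norm_num)) fun ζ hζ => by
        have hζc := hζ.contDiff.continuous
        -- The variation is the primitive of an arbitrary test function ζ, so integrating by parts
        -- onto ζ identifies `weakDeriv φ` with G directly.
        set η : ℝ → ℝ := fun x => ∫ y in (0 : ℝ)..x, ζ y with hηdef
        have hη : ∀ x, HasDerivAt η (ζ x) x := fun x =>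
          (hζc.integral_hasStrictDerivAt 0 x).hasDerivAt
        have hηc : Continuous η := continuous_iff_continuousAt.2 fun x => (hη x).continuousAt
        have hη0 : η 0 = 0 := intervalIntegral.integral_same
        have e := h.first_variation hη hζc hη0
        have ibp := intervalIntegral.integral_mul_deriv_eq_deriv_mul (a := 0) (b := 1)
          (fun x _ => hη x) (fun x _ => hSd x)
          (hζc.intervalIntegrable _ _) (hsc.intervalIntegrable _ _)
        rw [hη0, hS1, mul_zero, zero_mul, sub_zero, zero_sub] at ibp
        rw [integral_zero_one_eq, integral_zero_one_eq] at ibp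
        have hζL : MemLp ζ 2 unitVol := memLp_of_continuousOn hζc.continuousOn
        have i1 : Integrable (fun x => η x * s x) unitVol :=
          integrable_of_continuousOn (by fun_prop)
        have i2 : Integrable (fun x => ζ x * S x) unitVol :=
          integrable_of_continuousOn (by fun_prop)
        have i3 : Integrable (fun x => (weakDeriv φ - G) x * ζ x) unitVol :=
          (hg.sub hGL).integrable_mul hζL
        have e2 : ∫ x, ((weakDeriv φ - G) x * ζ x + (η x * s x + ζ x * S x)) ∂unitVol = 0 := by
          have h4 := integral_const_mul (μ := unitVol) (4 : ℝ) fun x =>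
            (1 / 4 * (weakDeriv φ x * ζ x) + 1 / (8 * β ^ 2) * (sin (2 * φ x) * η x)
              - κ / 2 * ζ x)
          rw [e, mul_zero] at h4
          rw [← h4]
          refine integral_congr_ae (ae_unitVol_of_forall fun x hx => ?_)
          simp only [hG, hs, Pi.sub_apply, hf hx]
          have h5 : 1 / (8 * β ^ 2) = 1 / 4 * (1 / (2 * β ^ 2)) := by ring
          rw [h5]
          ring
        have i12 : Integrable (fun x => η x * s x + ζ x * S x) unitVol := i1.add i2
        rw [integral_add i3 i12, integral_add i1 i2, ibp] at e2
        rw [integral_zero_one_eq]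
        linarith
    filter_upwards [this] with x hx
    simpa [sub_eq_zero] using hx
  set W : ℝ → ℝ := fun x => ∫ y in (0 : ℝ)..x, G y with hW
  have hWd : ∀ x, HasDerivAt W (G x) x := fun x => (hGc.integral_hasStrictDerivAt 0 x).hasDerivAt
  have hWc : Continuous W := continuous_iff_continuousAt.2 fun x => (hWd x).continuousAt
  have hφW : EqOn φ W (Icc 0 1) := by
    have h1 := hw.add_smul (memLp_of_continuousOn hφc) hg hWd hGc (-1)
    have h2 : IsWeakDeriv (fun x => φ x + -1 * W x) 0 := by
      intro η a b c
      rw [h1 η a b c, integral_zero_one_eq, integral_zero_one_eq]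
      congr 1
      refine integral_congr_ae ?_
      filter_upwards [hgG] with x hx
      simp [hx]
    have h3 := eq_zero_value_of_isWeakDeriv_zero (by fun_prop) h2
    intro x hx
    have h4 := h3 x hx
    have hW0 : W 0 = 0 := intervalIntegral.integral_same
    rw [hφ0, hW0] at h4
    linarith
  refine ⟨W, G, hφW, hWd, fun x hx => ((hSd x).add_const _).congr_deriv ?_, by simp [hG, hS1]⟩
  rw [← hφW hx, hf hx, hs]
  simp only [sin_two_mul]
  field_simp

/-- A minimizer is a rescaled profile. -/
theorem IsMinimizer.eq_profile {β κt : ℝ} (hβ : 0 < β) (hκ : 0 < κt) {φ : ℝ → ℝ}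
    (h : IsMinimizer β (κt / β) φ) :
    ∃ α, 0 < α ∧ α ≤ 2 * κt ∧ EqOn φ (fun x => profile α (x / β)) (Icc 0 1) := by
  obtain ⟨w, G, hφw, hw, hG, hG1⟩ := h.euler_lagrange
  have hL : 0 < 1 / β := by positivity
  have hmem : ∀ x ∈ Icc 0 (1 / β), β * x ∈ Icc (0 : ℝ) 1 := fun x hx =>
    ⟨mul_nonneg hβ.le hx.1, by have := hx.2; rw [le_div_iff₀ hβ] at this; linarith⟩
  set u : ℝ → ℝ := fun x => w (β * x) with hu_def
  set v : ℝ → ℝ := fun x => β * G (β * x) with hv_def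
  have hmul : ∀ x, HasDerivAt (fun x => β * x) β x := fun x => by
    simpa using (hasDerivAt_id x).const_mul β
  have hu : ∀ x ∈ Icc 0 (1 / β), HasDerivWithinAt u (v x) (Icc 0 (1 / β)) x := fun x _ =>
    (((hw (β * x)).comp x (hmul x)).congr_deriv (mul_comm _ _)).hasDerivWithinAt
  have hv : ∀ x ∈ Icc 0 (1 / β),
      HasDerivWithinAt v (sin (u x) * cos (u x)) (Icc 0 (1 / β)) x := fun x hx => by
    refine ((((hG (β * x) (hmem x hx)).comp x (hmul x)).const_mul β).congr_deriv
      ?_).hasDerivWithinAt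
    simp only [hu_def]
    field_simp
  have hu0 : u 0 = 0 := by
    have := hφw (left_mem_Icc.2 zero_le_one)
    rw [h.1.2.2] at this
    simp [hu_def, ← this]
  have hvL : v (1 / β) = 2 * κt := by
    simp only [hv_def, mul_one_div_cancel hβ.ne', hG1]
    field_simp
  have h0L : (1 / β) ∈ Icc 0 (1 / β) := ⟨hL.le, le_rfl⟩
  -- The sign comes from the far end, where v = 2κt > 0. A negative initial slope would, by
  -- reflection u ↦ -u, keep v negative; a zero one gives |u'| = |sin u| ≤ |u|, hence u = 0 and v =
  -- 0 at the end.
  have hpos : 0 < v 0 := by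
    rcases lt_trichotomy (v 0) 0 with hneg | hzero | hpos
    · have := (trajectory_eq_profile (u := fun x => -u x) (v := fun x => -v x) hL
        (neg_pos.2 hneg) (fun x hx => (hu x hx).neg)
        (fun x hx => (hv x hx).neg.congr_deriv (by simp)) (by simp [hu0]) rfl _ h0L).2
      have h2 := speed_nonneg (-v 0) (-u (1 / β))
      rw [← this, hvL] at h2
      linarith
    · have hsq : ∀ x ∈ Icc 0 (1 / β), v x ^ 2 = sin (u x) ^ 2 := by
        intro x hx
        have := eq_zero_value_of_hasDerivWithinAt_zero
          (f := fun x => v x ^ 2 - sin (u x) ^ 2) hL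
          (fun x hx => by
            refine (((hv x hx).pow 2).sub ((hu x hx).sin.pow 2)).congr_deriv ?_
            push_cast; ring) x hx
        simp [hu0, hzero] at this
        linarith
      have := eq_zero_of_abs_deriv_le_mul_abs_self_of_eq_zero_right (f := u) (f' := v) (K := 1)
        (a := 0) (b := 1 / β) (fun x hx => (hu x hx).continuousWithinAt)
        (fun x _ => (((hw (β * x)).comp x (hmul x)).congr_deriv (mul_comm _ _)).hasDerivWithinAt)
        hu0 (fun x hx => by
          rw [one_mul, Real.norm_eq_abs, Real.norm_eq_abs,
            sq_eq_sq_iff_abs_eq_abs _ _ |>.1 (hsq x (Ico_subset_Icc_self hx))]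
          exact abs_sin_le_abs) (1 / β) h0L
      have h2 := hsq _ h0L
      rw [this, hvL, sin_zero] at h2
      nlinarith
    · exact hpos
  have htraj := trajectory_eq_profile hL hpos hu hv hu0 rfl
  refine ⟨v 0, hpos, ?_, fun x hx => ?_⟩
  · rw [← hvL, (htraj _ h0L).2]
    exact le_speed _
  · have hx' : x / β ∈ Icc 0 (1 / β) :=
      ⟨div_nonneg hx.1 hβ.le, (div_le_div_iff_of_pos_right hβ).2 hx.2⟩
    have := (htraj _ hx').1
    rw [hφw hx]
    simpa [hu_def, mul_div_cancel₀ x hβ.ne'] using this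

/-! ### Energy of profiles and location of the slope -/

/-- Integral of the Bogomolny weight against which the energy of a profile is compared. -/
noncomputable def potential (κt α θ : ℝ) : ℝ := ∫ y in (0 : ℝ)..θ, (1 / 4 * speed α y - κt / 2)

theorem hasDerivAt_potential (κt α θ : ℝ) :
    HasDerivAt (potential κt α) (1 / 4 * speed α θ - κt / 2) θ := by
  have hc : Continuous fun y => 1 / 4 * speed α y - κt / 2 := by
    have := continuous_speed α
    fun_prop
  exact (hc.integral_hasStrictDerivAt 0 θ).hasDerivAt

theorem integral_speed_pi (α : ℝ) :
    ∫ y in (0 : ℝ)..π, speed α y = 2 * ∫ y in (0 : ℝ)..(π / 2), speed α y := by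
  have hi := fun a b => (continuous_speed α).intervalIntegrable (μ := volume) a b
  have h := intervalIntegral.integral_comp_sub_left (a := 0) (b := π / 2) (speed α) π
  have hsymm : ∀ y, speed α (π - y) = speed α y := fun y => by simp [speed]
  simp only [hsymm, sub_zero] at h
  rw [show π - π / 2 = π / 2 by ring] at h
  rw [← intervalIntegral.integral_add_adjacent_intervals (hi 0 (π / 2)) (hi (π / 2) π), ← h]
  ring

/-- The hypothesis says that the integrand of `potential` has zero mean over a period, so
`potential` is itself π-periodic, and a continuous periodic function is bounded. -/
theorem exists_potential_bound {κt α : ℝ}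
    (h : ∫ y in (0 : ℝ)..(π / 2), speed α y = κt * π) :
    ∃ P, 0 < P ∧ ∀ θ, |potential κt α θ| ≤ P := by
  have hc : Continuous fun y => 1 / 4 * speed α y - κt / 2 := by
    have := continuous_speed α
    fun_prop
  have hper : Function.Periodic (fun y => 1 / 4 * speed α y - κt / 2) π := fun y => by
    simp [speed_periodic α y]
  have hzero : ∫ y in (0 : ℝ)..π, (1 / 4 * speed α y - κt / 2) = 0 := by
    rw [intervalIntegral.integral_sub
      (((continuous_speed α).const_mul _).intervalIntegrable _ _) (by simp),
      intervalIntegral.integral_const_mul, integral_speed_pi, h,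
      intervalIntegral.integral_const, smul_eq_mul]
    ring
  have hpot : Function.Periodic (potential κt α) π := fun θ => by
    have := hper.intervalIntegral_add_eq_add 0 θ fun a b => hc.intervalIntegrable a b
    rwa [zero_add, hzero, add_zero] at this
  obtain ⟨P, hP⟩ := (hpot.isBounded_of_continuous pi_ne_zero (continuous_iff_continuousAt.2
    fun θ => (hasDerivAt_potential κt α θ).continuousAt)).exists_norm_le
  refine ⟨max P 1, by positivity, fun θ => ?_⟩
  exact (hP _ (mem_range_self θ)).trans (le_max_left _ _)

/-- With p = βφ' and s = `speed α₀ φ`, s² = α₀² + sin² φ gives p² + sin² φ = (p - s)² + 2ps - α₀².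
The term 2ps joins the linear term -4κt p into an exact derivative, that of `potential` along φ. -/
theorem energyF_eq_of_eqOn_profile {β κt α α₀ : ℝ} (hβ : 0 < β) (hα : 0 < α) {φ : ℝ → ℝ}
    (hφ : EqOn φ (fun x => profile α (x / β)) (Icc 0 1)) :
    energyF β (κt / β) φ = -α₀ ^ 2 / (8 * β ^ 2)
      + 1 / β * potential κt α₀ (profile α (1 / β))
      + 1 / (8 * β ^ 2) * ∫ x in (0 : ℝ)..1,
        (speed α (profile α (x / β)) - speed α₀ (profile α (x / β))) ^ 2 := by
  set w : ℝ → ℝ := fun x => profile α (x / β) with hwdef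
  have hw : ∀ x, HasDerivAt w (speed α (w x) / β) x := fun x => by
    refine ((hasDerivAt_profile hα (x / β)).comp x ((hasDerivAt_id x).div_const β)).congr_deriv ?_
    simp [hwdef, div_eq_mul_inv]
  have hwc : Continuous w := continuous_iff_continuousAt.2 fun x => (hw x).continuousAt
  have hsc := continuous_speed α
  have hsc₀ := continuous_speed α₀
  have hgc : Continuous fun x => speed α (w x) / β := by fun_prop
  have hgL : MemLp (fun x => speed α (w x) / β) 2 unitVol :=
    memLp_of_continuousOn hgc.continuousOn
  have hint : ∫ x in (0 : ℝ)..1, (1 / 4 * speed α₀ (w x) - κt / 2) * (speed α (w x) / β)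
      = potential κt α₀ (profile α (1 / β)) := by
    rw [intervalIntegral.integral_eq_sub_of_hasDerivAt (f := fun x => potential κt α₀ (w x))
      (fun x _ => (hasDerivAt_potential κt α₀ (w x)).comp x (hw x))
      (Continuous.intervalIntegrable (by fun_prop) _ _)]
    simp [hwdef, profile_zero hα, potential]
  rw [energyF_eq_integral (hwc.continuousOn.congr hφ) hgL
    (weakDeriv_ae_eq hgL (isWeakDeriv_of_hasDerivAt hφ hw hgc)), ← hint, integral_zero_one_eq,
    integral_zero_one_eq]
  have i1 : Integrable (fun _ : ℝ => -α₀ ^ 2 / (8 * β ^ 2)) unitVol := integrable_const _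
  have i2 : Integrable (fun x => 1 / β *
      ((1 / 4 * speed α₀ (w x) - κt / 2) * (speed α (w x) / β))) unitVol :=
    integrable_of_continuousOn (Continuous.continuousOn (by fun_prop))
  have i3 : Integrable (fun x => 1 / (8 * β ^ 2) * (speed α (w x) - speed α₀ (w x)) ^ 2)
      unitVol := integrable_of_continuousOn (Continuous.continuousOn (by fun_prop))
  have hconst : ∫ _, -α₀ ^ 2 / (8 * β ^ 2) ∂unitVol = -α₀ ^ 2 / (8 * β ^ 2) := by
    rw [← integral_zero_one_eq]
    simp
  have i12 : Integrable (fun x => -α₀ ^ 2 / (8 * β ^ 2) + 1 / β *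
      ((1 / 4 * speed α₀ (w x) - κt / 2) * (speed α (w x) / β))) unitVol := i1.add i2
  change _ = _ + _ + 1 / (8 * β ^ 2) * ∫ x, (speed α (w x) - speed α₀ (w x)) ^ 2 ∂unitVol
  rw [← hconst, ← integral_const_mul, ← integral_const_mul, ← integral_add i1 i2,
    ← integral_add i12 i3]
  refine integral_congr_ae (ae_unitVol_of_forall fun x hx => ?_)
  have h2 := sq_speed α₀ (w x)
  simp only [hφ hx]
  field_simp
  linear_combination (-8) * h2

theorem profile_mem_spaceJ {β α : ℝ} (hα : 0 < α) :
    (fun x => profile α (x / β)) ∈ spaceJ := by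
  have hw : ∀ x, HasDerivAt (fun x => profile α (x / β)) (speed α (profile α (x / β)) / β) x :=
    fun x => by
      refine ((hasDerivAt_profile hα (x / β)).comp x
        ((hasDerivAt_id x).div_const β)).congr_deriv ?_
      simp [div_eq_mul_inv]
  have hc : Continuous fun x => profile α (x / β) :=
    continuous_iff_continuousAt.2 fun x => (hw x).continuousAt
  have hsc := continuous_speed α
  have hgc : Continuous fun x => speed α (profile α (x / β)) / β := by fun_prop
  exact ⟨⟨memLp_of_continuousOn hc.continuousOn, _, memLp_of_continuousOn hgc.continuousOn,
    isWeakDeriv_of_hasDerivAt (fun _ _ => rfl) hw hgc⟩, hc.continuousOn,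
    by simp [profile_zero hα]⟩

/-- The energy of minimizers and the slope of the corresponding profiles as `β → 0`. -/
theorem exists_minimizer_bounds {κt α₀ : ℝ} (hκ : 0 < κt) (hα₀ : 0 < α₀) (hα₀κ : α₀ ≤ 2 * κt)
    (h : ∫ y in (0 : ℝ)..(π / 2), speed α₀ y = κt * π) :
    ∃ M D, 0 < M ∧ 0 < D ∧ ∀ β, 0 < β → ∀ φ, IsMinimizer β (κt / β) φ →
      |energyF β (κt / β) φ - (-α₀ ^ 2 / (8 * β ^ 2))| ≤ M / β ∧
      ∃ α, 0 < α ∧ α ≤ 2 * κt ∧ EqOn φ (fun x => profile α (x / β)) (Icc 0 1) ∧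
        (α - α₀) ^ 2 ≤ D * β := by
  obtain ⟨P, hP0, hP⟩ := exists_potential_bound h
  set A := √((2 * κt) ^ 2 + 1) with hA
  have hApos : 0 < A := sqrt_pos.2 (by positivity)
  -- P bounds `potential`. The second constant is 16P, from I ≤ 16Pβ, times 4A²/α₀², from the
  -- pointwise lower bound on the square.
  refine ⟨P, 64 * P * A ^ 2 / α₀ ^ 2, hP0, by positivity, fun β hβ φ hφ => ?_⟩
  obtain ⟨α, hα, hακ, hφα⟩ := hφ.eq_profile hβ hκ
  have hE := energyF_eq_of_eqOn_profile (κt := κt) (α₀ := α₀) hβ hα hφα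
  have hE₀ := energyF_eq_of_eqOn_profile (κt := κt) (α₀ := α₀) hβ hα₀
    (φ := fun x => profile α₀ (x / β)) fun _ _ => rfl
  have hle := hφ.2 _ (profile_mem_spaceJ (β := β) hα₀)
  set I := ∫ x in (0 : ℝ)..1,
    (speed α (profile α (x / β)) - speed α₀ (profile α (x / β))) ^ 2 with hI
  have hI0 : 0 ≤ I := intervalIntegral.integral_nonneg zero_le_one fun x _ => sq_nonneg _
  simp only [sub_self, ne_eq, OfNat.ofNat_ne_zero, not_false_eq_true, zero_pow,
    intervalIntegral.integral_zero, mul_zero, add_zero] at hE₀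
  have hp1 := abs_le.1 (hP (profile α (1 / β)))
  have hp2 := abs_le.1 (hP (profile α₀ (1 / β)))
  have hm1 : -(P / β) ≤ 1 / β * potential κt α₀ (profile α (1 / β)) := by
    rw [← neg_div, div_mul_eq_mul_div, one_mul]
    exact (div_le_div_iff_of_pos_right hβ).2 hp1.1
  have hm2 : 1 / β * potential κt α₀ (profile α₀ (1 / β)) ≤ P / β := by
    rw [div_mul_eq_mul_div, one_mul]
    exact (div_le_div_iff_of_pos_right hβ).2 hp2.2
  have hI1 : 0 ≤ 1 / (8 * β ^ 2) * I := by positivity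
  -- Lower bound: drop the square. Upper bound: the competitor `profile α₀`, whose square term
  -- vanishes.
  refine ⟨abs_le.2 ⟨by linarith, by linarith⟩, α, hα, hακ, hφα, ?_⟩
  have hI2 : 1 / (8 * β ^ 2) * I ≤ 2 * P / β := by
    rw [mul_div_assoc]
    linarith
  have hI3 : I ≤ 16 * P * β := by
    rw [div_mul_eq_mul_div, one_mul, div_le_div_iff₀ (by positivity) hβ] at hI2
    nlinarith
  have hpt : ∀ y, (α - α₀) ^ 2 * α₀ ^ 2 / (4 * A ^ 2) ≤ (speed α y - speed α₀ y) ^ 2 := by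
    intro y
    have hb : ∀ a, 0 < a → a ≤ 2 * κt → speed a y ≤ A := fun a ha ha' =>
      (speed_le a y).trans (sqrt_le_sqrt (by nlinarith))
    have h1 := hb α hα hακ
    have h2 := hb α₀ hα₀ hα₀κ
    -- The sin² terms cancel in the difference of squared speeds, so closeness of speeds forces
    -- closeness of slopes.
    have h3 : (speed α y - speed α₀ y) * (speed α y + speed α₀ y) = (α - α₀) * (α + α₀) := by
      linear_combination sq_speed α y - sq_speed α₀ y
    rw [div_le_iff₀ (by positivity)]
    calc (α - α₀) ^ 2 * α₀ ^ 2 ≤ (α - α₀) ^ 2 * (α + α₀) ^ 2 := by gcongr; linarith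
      _ = (speed α y - speed α₀ y) ^ 2 * (speed α y + speed α₀ y) ^ 2 := by
        rw [← mul_pow, ← mul_pow, h3]
      _ ≤ (speed α y - speed α₀ y) ^ 2 * (A + A) ^ 2 := by
        have := speed_nonneg α y
        have := speed_nonneg α₀ y
        gcongr
      _ = _ := by ring
  have hIlow : (α - α₀) ^ 2 * α₀ ^ 2 / (4 * A ^ 2) ≤ I := by
    have hc : Continuous fun x =>
        (speed α (profile α (x / β)) - speed α₀ (profile α (x / β))) ^ 2 := by
      have := continuous_speed α
      have := continuous_speed α₀
      have := continuous_profile hα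
      fun_prop
    have := intervalIntegral.integral_mono_on (μ := volume) zero_le_one
      (intervalIntegrable_const (c := (α - α₀) ^ 2 * α₀ ^ 2 / (4 * A ^ 2)))
      (hc.intervalIntegrable 0 1) fun x _ => hpt (profile α (x / β))
    simpa using this
  have := hIlow.trans hI3
  rw [div_le_iff₀ (by positivity)] at this
  rw [div_mul_eq_mul_div, le_div_iff₀ (by positivity)]
  linarith

/-! ### The limiting slope and bounds on the period -/

theorem strictMonoOn_integral_speed :
    StrictMonoOn (fun α => ∫ y in (0 : ℝ)..(π / 2), speed α y) (Ici 0) := by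
  intro a ha b _ hab
  have hlt : ∀ y, speed a y < speed b y := fun y =>
    sqrt_lt_sqrt (by positivity) (by
      have := pow_lt_pow_left₀ hab ha two_ne_zero
      linarith)
  exact intervalIntegral.integral_lt_integral_of_continuousOn_of_le_of_exists_lt
    (by positivity) (continuous_speed a).continuousOn (continuous_speed b).continuousOn
    (fun y _ => (hlt y).le) ⟨0, ⟨le_rfl, by positivity⟩, hlt 0⟩

/-- Intermediate values on [0, 2κt]: at slope 0 the integral is that of sine, namely 1 < κt π, while
at 2κt it is at least 2κt · π/2. The assumption κt > 1/π is exactly what excludes α₀ = 0. -/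
theorem exists_slope {κt : ℝ} (hκt : 1 / π < κt) :
    ∃ α₀, 0 < α₀ ∧ α₀ ≤ 2 * κt ∧ ∫ y in (0 : ℝ)..(π / 2), speed α₀ y = κt * π := by
  have hκ : 0 < κt := lt_trans (by positivity) hκt
  have hc : Continuous fun α => ∫ y in (0 : ℝ)..(π / 2), speed α y :=
    intervalIntegral.continuous_parametric_intervalIntegral_of_continuous' (by
      unfold speed
      fun_prop) _ _
  have h0 : ∫ y in (0 : ℝ)..(π / 2), speed 0 y = 1 := by
    rw [intervalIntegral.integral_congr (g := sin) fun y hy => ?_, integral_sin]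
    · simp
    · rw [uIcc_of_le (by positivity)] at hy
      have := sin_nonneg_of_nonneg_of_le_pi hy.1 (by linarith [hy.2, pi_pos])
      simp [speed, sqrt_sq this]
  have h1 : κt * π ≤ ∫ y in (0 : ℝ)..(π / 2), speed (2 * κt) y := by
    have := intervalIntegral.integral_mono_on (μ := volume) (a := 0) (b := π / 2) (by positivity)
      (intervalIntegrable_const (c := 2 * κt))
      ((continuous_speed (2 * κt)).intervalIntegrable _ _) fun y _ => le_speed y
    rw [intervalIntegral.integral_const, smul_eq_mul] at this
    linarith
  have hlt : 1 < κt * π := (div_lt_iff₀ pi_pos).1 hκt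
  obtain ⟨α₀, hα₀, h⟩ := intermediate_value_Icc (a := 0) (b := 2 * κt) (by positivity)
    hc.continuousOn ⟨h0.trans_le hlt.le, h1⟩
  refine ⟨α₀, lt_of_le_of_ne hα₀.1 fun he => ?_, hα₀.2, h⟩
  rw [← he] at h
  exact hlt.ne (h0.symm.trans h)

theorem arrival_pi_le {α : ℝ} (hα : 0 < α) : arrival α π ≤ π / α := by
  have := intervalIntegral.integral_mono_on (μ := volume) pi_pos.le
    ((continuous_inv_speed hα).intervalIntegrable _ _) (intervalIntegrable_const (c := α⁻¹))
    fun y _ => inv_anti₀ hα (le_speed y)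
  simpa [arrival, div_eq_mul_inv] using this

theorem le_arrival_pi {α : ℝ} (hα : 0 < α) : π / √(α ^ 2 + 1) ≤ arrival α π := by
  have := intervalIntegral.integral_mono_on (μ := volume) pi_pos.le
    (intervalIntegrable_const (c := (√(α ^ 2 + 1))⁻¹))
    ((continuous_inv_speed hα).intervalIntegrable _ _)
    fun y _ => inv_anti₀ (speed_pos hα y) (speed_le α y)
  simpa [arrival, div_eq_mul_inv] using this

/-! ### The limit profile and convergence of derivatives -/

theorem iteratedDerivWithin_two_of_trajectory {s : Set ℝ} {u v : ℝ → ℝ} (hs : UniqueDiffOn ℝ s)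
    (hu : ∀ x ∈ s, HasDerivWithinAt u (v x) s x)
    (hv : ∀ x ∈ s, HasDerivWithinAt v (sin (u x) * cos (u x)) s x) {x : ℝ} (hx : x ∈ s) :
    iteratedDerivWithin 2 u s x = sin (u x) * cos (u x) := by
  have h : EqOn (iteratedDerivWithin 1 u s) v s := fun y hy => by
    rw [iteratedDerivWithin_one, (hu y hy).derivWithin (hs y hy)]
  rw [iteratedDerivWithin_succ]
  exact ((hv x hx).congr h (h hx)).derivWithin (hs x hx)

theorem isProfile_profile {α : ℝ} (hα : 0 < α) : IsProfile α (profile α) where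
  contDiffOn := (contDiff_profile hα).contDiffOn.of_le (WithTop.coe_le_coe.2 le_top)
  ode x hx := iteratedDerivWithin_two_of_trajectory (uniqueDiffOn_Ici 0)
    (fun x _ => (hasDerivAt_profile hα x).hasDerivWithinAt)
    (fun x _ => (hasDerivAt_speed_profile hα x).hasDerivWithinAt) (Ioi_subset_Ici_self hx)
  map_zero := profile_zero hα
  slope_zero := by
    rw [(hasDerivAt_profile hα 0).hasDerivWithinAt.derivWithin
      (uniqueDiffOn_Ici (0 : ℝ) 0 self_mem_Ici)]
    simp [speed, profile_zero hα, sqrt_sq hα.le]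

theorem IsProfile.eqOn_profile {α : ℝ} (hα : 0 < α) {ψ : ℝ → ℝ} (h : IsProfile α ψ) :
    EqOn ψ (profile α) (Ici 0) := by
  have hs := uniqueDiffOn_Ici (0 : ℝ)
  have hd : DifferentiableOn ℝ ψ (Ici 0) := h.contDiffOn.differentiableOn (by norm_num)
  have h1 : iteratedDerivWithin 1 ψ (Ici 0) = derivWithin ψ (Ici 0) := by
    ext x
    rw [iteratedDerivWithin_one]
  have hd' : DifferentiableOn ℝ (derivWithin ψ (Ici 0)) (Ici 0) := by
    rw [← h1]
    exact h.contDiffOn.differentiableOn_iteratedDerivWithin (by norm_num) hs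
  -- The equation is given only on the open half-line; continuity of the second derivative carries
  -- it to 0.
  have h2 : EqOn (iteratedDerivWithin 2 ψ (Ici 0)) (fun x => sin (ψ x) * cos (ψ x)) (Ici 0) := by
    refine EqOn.of_subset_closure (s := Ioi 0) h.ode
      (h.contDiffOn.continuousOn_iteratedDerivWithin (by norm_num) hs) ?_ Ioi_subset_Ici_self
      (closure_Ioi (0 : ℝ)).symm.subset
    have := hd.continuousOn
    fun_prop
  intro x hx
  -- Working up to x + 1 keeps the interval nondegenerate when x = 0.
  have hsub : Icc 0 (x + 1) ⊆ Ici (0 : ℝ) := Icc_subset_Ici_self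
  have hx0 : 0 ≤ x := hx
  refine (trajectory_eq_profile (u := ψ) (v := derivWithin ψ (Ici 0)) (L := x + 1)
    (by positivity) hα (fun y hy => ((hd y (hsub hy)).hasDerivWithinAt).mono hsub)
    (fun y hy => ?_) h.map_zero h.slope_zero x ⟨hx, by linarith⟩).1
  refine (((hd' y (hsub hy)).hasDerivWithinAt).mono hsub).congr_deriv ?_
  rw [← h1, ← iteratedDerivWithin_succ]
  exact h2 (hsub hy)

/-- Derivatives of profiles depend on the initial slope continuously, uniformly on compact sets and
with respect to the domain on which they are taken. -/
theorem exists_iteratedDerivWithin_profile_close {α₀ : ℝ} (hα₀ : 0 < α₀) (R : ℝ) (k : ℕ) {ε : ℝ}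
    (hε : 0 < ε) : ∃ δ, 0 < δ ∧ ∀ α, 0 < α → |α - α₀| < δ → ∀ s t : Set ℝ, UniqueDiffOn ℝ s →
      UniqueDiffOn ℝ t → ∀ x ∈ s, x ∈ t → x ∈ Icc 0 R →
        |iteratedDerivWithin k (profile α) s x - iteratedDerivWithin k (profile α₀) t x| < ε := by
  obtain ⟨Q, hQ, hjet⟩ := exists_iteratedDerivWithin_eq k
  have hpc : Continuous fun x => (profile α₀ x, speed α₀ (profile α₀ x)) :=
    (continuous_profile hα₀).prodMk ((continuous_speed α₀).comp (continuous_profile hα₀))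
  obtain ⟨r, hr⟩ := (isCompact_Icc (a := 0) (b := R)).exists_bound_of_continuousOn hpc.continuousOn
  obtain ⟨d, hd, hQd⟩ := Metric.uniformContinuousOn_iff.1
    ((isCompact_closedBall (0 : ℝ × ℝ) (r + 1)).uniformContinuousOn_of_continuous
      hQ.continuous.continuousOn) ε hε
  have hm : 0 < min d 1 := lt_min hd one_pos
  -- The pairs (u, u') of the two profiles differ by at most |α - α₀|(1 + e^R) on [0, R]. The cap 1
  -- keeps them in the ball of radius r + 1, where Q is uniformly continuous with modulus d.
  refine ⟨min d 1 / (1 + exp R), by positivity, fun α hα hlt s t hs ht x hxs hxt hx => ?_⟩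
  rw [lt_div_iff₀ (by positivity)] at hlt
  have hdist : dist (profile α x, speed α (profile α x)) (profile α₀ x, speed α₀ (profile α₀ x))
      < min d 1 := by
    have h1 : |profile α x - profile α₀ x| ≤ |α - α₀| * exp R :=
      (abs_profile_sub_le hα hα₀ hx.1).trans
        (mul_le_mul_of_nonneg_left (exp_le_exp.2 hx.2) (abs_nonneg _))
    have h2 := abs_speed_sub_le α α₀ (profile α x) (profile α₀ x)
    rw [Prod.dist_eq, Real.dist_eq, Real.dist_eq]
    refine lt_of_le_of_lt (max_le ?_ ?_) hlt
    · nlinarith [abs_nonneg (α - α₀)]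
    · linarith
  rw [hjet s (profile α) _ hs (fun x _ => (hasDerivAt_profile hα x).hasDerivWithinAt)
      (fun x _ => (hasDerivAt_speed_profile hα x).hasDerivWithinAt) x hxs,
    hjet t (profile α₀) _ ht (fun x _ => (hasDerivAt_profile hα₀ x).hasDerivWithinAt)
      (fun x _ => (hasDerivAt_speed_profile hα₀ x).hasDerivWithinAt) x hxt, ← Real.dist_eq]
  have hr' := hr x hx
  rw [← dist_zero_right] at hr'
  refine hQd _ ?_ _ ?_ (hdist.trans_le (min_le_left _ _))
  · rw [Metric.mem_closedBall]
    exact (dist_triangle _ _ _).trans (by linarith [hdist.trans_le (min_le_right d 1)])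
  · rw [Metric.mem_closedBall]
    linarith

/-! ### Quasi-periodicity and the number of periods -/

/-- Smoothness, quasi-periodicity and the size of the quasi-period of a rescaled profile. -/
theorem quasiperiodic_of_eqOn_profile {β α α₀ κt : ℝ} (hβ : 0 < β) (hα : 0 < α) (hα₀ : 0 < α₀)
    (hακ : α ≤ 2 * κt) (hlow : α₀ / 2 ≤ α) (hβα : β < α₀ / (2 * π)) {φ : ℝ → ℝ}
    (hφ : EqOn φ (fun x => profile α (x / β)) (Icc 0 1)) :
    ContDiffOn ℝ ∞ φ (Icc 0 1) ∧ (∃! T : ℝ, T ∈ Ioo (0 : ℝ) 1 ∧ φ T = π) ∧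
      ∀ T ∈ Ioo (0 : ℝ) 1, φ T = π →
        (∀ x ∈ Icc (0 : ℝ) (1 - T), φ (x + T) = π + φ x) ∧
        α₀ / (4 * π) / β ≤ (⌊1 / T⌋₊ : ℝ) ∧
        (⌊1 / T⌋₊ : ℝ) ≤ (√((2 * κt) ^ 2 + 1) / π + α₀ / (4 * π)) / β := by
  set A := √((2 * κt) ^ 2 + 1) with hA
  have hApos : 0 < A := sqrt_pos.2 (by positivity)
  set τ := arrival α π with hτ
  have hτlow : π / A ≤ τ := by
    refine le_trans ?_ (le_arrival_pi hα)
    have : √(α ^ 2 + 1) ≤ A := sqrt_le_sqrt (by nlinarith)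
    gcongr
  have hτpos : 0 < τ := lt_of_lt_of_le (by positivity) hτlow
  have hτup : τ ≤ 2 * π / α₀ := by
    refine (arrival_pi_le hα).trans ?_
    rw [div_le_div_iff₀ hα hα₀]
    nlinarith [pi_pos]
  have hT1 : β * τ < 1 := by
    rw [lt_div_iff₀ (by positivity)] at hβα
    rw [le_div_iff₀ hα₀] at hτup
    have : β * (τ * α₀) ≤ β * (2 * π) := by gcongr
    nlinarith
  -- Injectivity of the profile leaves a single candidate, the rescaled arrival time at height π.
  have hπ : ∀ T ∈ Ioo (0 : ℝ) 1, φ T = π → T = β * τ := fun T hT h => by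
    rw [hφ (Ioo_subset_Icc_self hT), ← profile_arrival hα π] at h
    have := (strictMono_profile hα).injective h
    field_simp at this
    linarith
  refine ⟨?_, ⟨β * τ, ⟨⟨by positivity, hT1⟩, ?_⟩, fun T hT => hπ T hT.1 hT.2⟩, ?_⟩
  · have hc : ContDiff ℝ ∞ fun x => profile α (x / β) :=
      (contDiff_profile hα).comp (contDiff_id.div_const β)
    exact hc.contDiffOn.congr hφ
  · rw [hφ ⟨by positivity, hT1.le⟩]
    simp only [mul_div_cancel_left₀ τ hβ.ne']
    rw [hτ, profile_arrival hα]
  · intro T hT hφT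
    refine ⟨fun x hx => ?_, ?_⟩
    · have hTτ : T / β = τ := by rw [hπ T hT hφT, mul_div_cancel_left₀ τ hβ.ne']
      rw [hφ ⟨add_nonneg hx.1 hT.1.le, by linarith [hx.2]⟩, hφ ⟨hx.1, by linarith [hx.2, hT.1]⟩]
      simp only [add_div, hTτ, hτ, profile_add_arrival_pi hα]
      ring
    · have hinv : 1 / T = 1 / (β * τ) := by rw [hπ T hT hφT]
      have h1 : 1 ≤ 1 / T := (one_le_div hT.1).2 hT.2.le
      have hfl : (⌊1 / T⌋₊ : ℝ) ≤ 1 / T := Nat.floor_le (by positivity)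
      -- A floor that is at least 1 is at least half of its argument; hence the 4π in the lower
      -- constant, against 2π in the bound on 1/T.
      have hfl1 : (1 : ℝ) ≤ ⌊1 / T⌋₊ := by exact_mod_cast Nat.one_le_floor_iff _ |>.2 h1
      have hfl2 := Nat.lt_floor_add_one (1 / T)
      have hlo : α₀ / (2 * π) / β ≤ 1 / T := by
        rw [hinv, div_div, div_le_div_iff₀ (by positivity) (by positivity)]
        rw [le_div_iff₀ hα₀] at hτup
        have : β * (τ * α₀) ≤ β * (2 * π) := by gcongr
        linarith
      have hup : 1 / T ≤ A / π / β := by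
        rw [hinv, div_div, div_le_div_iff₀ (by positivity) (by positivity)]
        rw [div_le_iff₀ hApos] at hτlow
        have : β * π ≤ β * (τ * A) := by gcongr
        linarith
      constructor
      · have : α₀ / (4 * π) / β = α₀ / (2 * π) / β / 2 := by field_simp; norm_num
        linarith
      · rw [add_div]
        have : 0 ≤ α₀ / (4 * π) / β := by positivity
        linarith

end Stripes

/-! ### Assembly -/

theorem theorem2 (κt : ℝ) (hκt : 1 / π < κt) :
    ∃ α₀ : ℝ,
      -- existence, bounds and uniqueness of `α₀`
      (0 < α₀ ∧ α₀ ≤ 2 * κt ∧ ∫ y in (0 : ℝ)..(π / 2), √(α₀ ^ 2 + sin y ^ 2) = κt * π) ∧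
      (∀ α : ℝ, 0 < α → ∫ y in (0 : ℝ)..(π / 2), √(α ^ 2 + sin y ^ 2) = κt * π → α = α₀) ∧
      -- period, quasi-periodicity, number of periods, energy, for all small `β`
      (∃ β₀ c C M : ℝ, 0 < β₀ ∧ 0 < c ∧ c < C ∧ 0 < M ∧
        ∀ β : ℝ, 0 < β → β < β₀ →
          ∀ φ : ℝ → ℝ, Stripes.IsMinimizer β (κt / β) φ →
            ContDiffOn ℝ ∞ φ (Icc 0 1) ∧
            (∃! T : ℝ, T ∈ Ioo (0 : ℝ) 1 ∧ φ T = π) ∧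
            (∀ T ∈ Ioo (0 : ℝ) 1, φ T = π →
              (∀ x ∈ Icc (0 : ℝ) (1 - T), φ (x + T) = π + φ x) ∧
              c / β ≤ (⌊1 / T⌋₊ : ℝ) ∧ (⌊1 / T⌋₊ : ℝ) ≤ C / β) ∧
            |Stripes.energyF β (κt / β) φ - (-α₀ ^ 2 / (8 * β ^ 2))| ≤ M / β) ∧
      -- the limit profile, and convergence of all derivatives on compact sets
      ∃ φ₀ : ℝ → ℝ, Stripes.IsProfile α₀ φ₀ ∧
        (∀ ψ : ℝ → ℝ, Stripes.IsProfile α₀ ψ → EqOn ψ φ₀ (Ici 0)) ∧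
        ContDiffOn ℝ ∞ φ₀ (Ici 0) ∧
        ∀ K : Set ℝ, IsCompact K → K ⊆ Ici 0 → ∀ k : ℕ, ∀ ε : ℝ, 0 < ε →
          ∃ δ : ℝ, 0 < δ ∧ ∀ β : ℝ, 0 < β → β < δ →
            ∀ φ : ℝ → ℝ, Stripes.IsMinimizer β (κt / β) φ →
              K ⊆ Icc 0 (1 / β) ∧
              ∀ x ∈ K,
                |iteratedDerivWithin k (fun y => φ (β * y)) (Icc 0 (1 / β)) x
                  - iteratedDerivWithin k φ₀ (Ici 0) x| < ε := by
  have hκ : 0 < κt := lt_trans (by positivity) hκt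
  obtain ⟨α₀, hα₀, hα₀κ, hint⟩ := Stripes.exists_slope hκt
  obtain ⟨M, D, hM, hD, hmin⟩ := Stripes.exists_minimizer_bounds hκ hα₀ hα₀κ hint
  have hclose : ∀ β α d : ℝ, 0 < d → β < d ^ 2 / D → (α - α₀) ^ 2 ≤ D * β → |α - α₀| < d := by
    intro β α d hd hβ h
    rw [lt_div_iff₀ hD] at hβ
    exact abs_lt_of_sq_lt_sq (by linarith) hd.le
  refine ⟨α₀, ⟨hα₀, hα₀κ, hint⟩, fun α hα h => ?_, ?_, Stripes.profile α₀,
    Stripes.isProfile_profile hα₀, fun ψ hψ => hψ.eqOn_profile hα₀,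
    (Stripes.contDiff_profile hα₀).contDiffOn, ?_⟩
  · exact Stripes.strictMonoOn_integral_speed.injOn hα.le hα₀.le (h.trans hint.symm)
  -- The first threshold forces α > α₀/2, and the second then puts the height π inside (0, 1). The
  -- summand α₀/(4π) in the upper constant serves only to make c < C.
  · refine ⟨min ((α₀ / 2) ^ 2 / D) (α₀ / (2 * π)), α₀ / (4 * π),
      √((2 * κt) ^ 2 + 1) / π + α₀ / (4 * π), M, by positivity, by positivity, ?_, hM,
      fun β hβ hβ₀ φ hφ => ?_⟩
    · have : 0 < √((2 * κt) ^ 2 + 1) / π := by positivity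
      linarith
    · obtain ⟨hE, α, hα, hακ, hφα, hsq⟩ := hmin β hβ φ hφ
      have hd := abs_lt.1 (hclose β α (α₀ / 2) (by positivity)
        (hβ₀.trans_le (min_le_left _ _)) hsq)
      obtain ⟨h1, h2, h3⟩ := Stripes.quasiperiodic_of_eqOn_profile hβ hα hα₀ hακ
        (by linarith [hd.1]) (hβ₀.trans_le (min_le_right _ _)) hφα
      exact ⟨h1, h2, h3, hE⟩
  · intro K hK hK0 k ε hε
    obtain ⟨R, hR⟩ := hK.bddAbove
    obtain ⟨d, hd, hclosed⟩ :=
      Stripes.exists_iteratedDerivWithin_profile_close hα₀ R k hε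
    -- The first threshold gives |α - α₀| < d; the second makes [0, 1/β] contain K.
    refine ⟨min (d ^ 2 / D) (1 / (|R| + 1)), by positivity, fun β hβ hβδ φ hφ => ?_⟩
    obtain ⟨-, α, hα, -, hφα, hsq⟩ := hmin β hβ φ hφ
    have hRβ : R ≤ 1 / β := by
      have := hβδ.trans_le (min_le_right _ _)
      rw [lt_div_iff₀ (by positivity)] at this
      rw [le_div_iff₀ hβ]
      nlinarith [le_abs_self R]
    have hKsub : K ⊆ Icc 0 (1 / β) := fun x hx => ⟨hK0 hx, (hR hx).trans hRβ⟩
    refine ⟨hKsub, fun x hx => ?_⟩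
    have heq : EqOn (fun y => φ (β * y)) (Stripes.profile α) (Icc 0 (1 / β)) := fun y hy => by
      have hy2 := hy.2
      rw [le_div_iff₀ hβ] at hy2
      have := hφα (x := β * y) ⟨mul_nonneg hβ.le hy.1, by linarith⟩
      simpa [mul_div_cancel_left₀ y hβ.ne'] using this
    rw [iteratedDerivWithin_congr heq (hKsub hx)]
    exact hclosed α hα (hclose β α d hd (hβδ.trans_le (min_le_left _ _)) hsq) _ _
      (uniqueDiffOn_Icc (by positivity)) (uniqueDiffOn_Ici 0) x (hKsub hx) (hK0 hx)
      ⟨hK0 hx, hR hx⟩
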